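/- For a square complex matrix $A$, let $A^D$ be its Drazin inverse, i.e. the unique matrix with $AA^D=A^DA$, $A^D=A^DAA^D$ and $A^m=A^{m+1}A^D$ for some $m\in\mathbb N$, and let $A^\pi=I-AA^D$. Let $P,Q\in\mathbb C^{n\times n}$ satisfy $PQ^2=0$ and $PQP(PQ)^\pi=0$. Put $$N=\begin{pmatrix}P&PQ\\ I&Q\end{pmatrix},\quad K=\begin{pmatrix}P&PQ\\ I&0\end{pmatrix},\quad L=\begin{pmatrix}0&0\\0&Q\end{pmatrix},\quad H=\begin{pmatrix}P&I\\ PQ&0\end{pmatrix}.$$ Then $$(P+Q)^D=(I,\ Q)\,(N^D)^2\begin{pmatrix}P\\ I\end{pmatrix},\qquad N^D=\sum_{i=0}^\infty (L^D)^{i+1}K^iK^\pi+\sum_{i=0}^\infty L^iL^\pi(K^D)^{i+1},$$ $$L^D=\begin{pmatrix}0&0\\0&Q^D\end{pmatrix},\qquad K^D=\begin{pmatrix}P&I\\ I&0\end{pmatrix}(H^D)^2\begin{pmatrix}I&0\\0&PQ\end{pmatrix},\qquad H^D=\begin{pmatrix}\Gamma&\Delta\\ \Lambda&\Xi\end{pmatrix},$$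 where, with $E=P$ and $F=PQ$, $$\begin{aligned} \Gamma={}&\sum_{i\ge0}(E^D)^{2i+1}F^iF^\pi+\Phi F^\pi EF^D+\sum_{i\ge1}U_iF^DC_i+\sum_{i\ge1}V_iA_i,\\ \Delta={}&F^D-E^DF^\pi EF^D-\sum_{i\ge1}(E^D)^{2i+1}F^iF^\pi EF^D+\sum_{i\ge0}(E^D)^{2i+2}F^iF^\pi\\ &-\Phi F^\pi EF^DEF^D+\sum_{i\ge1}U_iF^DD_i+\sum_{i\ge1}V_iB_i,\\ \Lambda={}&FF^D+\sum_{i\ge1}F^iF^\pi EA_i,\qquad \Xi=-FF^DEF^D+\sum_{i\ge1}F^iF^\pi EB_i, \end{aligned}$$ with $$\begin{aligned} \Phi={}&E^\pi-\sum_{j\ge1}(E^D)^{2j}F^jF^\pi,\\ U_i={}&\Phi F^iF^\pi E+E^\pi E^{2i}F^\pi EFF^D+\sum_{k=0}^{i-2}E^\pi E^{2k+2}F^{i-k-1}F^\pi E,\\ V_i={}&E^\pi E^{2i-1}F^\pi EFF^D-\sum_{j\ge0}(E^D)^{2j+1}F^{i+j}F^\pi E+\sum_{k=0}^{i-2}E^\pi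 E^{2k+1}F^{i-k-1}F^\pi E, \end{aligned}$$ and $$\begin{aligned} A_1&=-F^DEF^D, & B_1&=(F^D)^2+F^D(EF^D)^2,\\ C_1&=F^D+FF^D(EF^D)^2, & D_1&=-F^DEF^D-FF^DE(F^D)^2-FF^D(EF^D)^3,\\ A_{i+1}&=F^DA_i-F^DEF^DC_i, & C_{i+1}&=-FF^DEF^DA_i+\bigl(F^D+FF^D(EF^D)^2\bigr)C_i,\\ B_{i+1}&=F^DB_i-F^DEF^DD_i, & D_{i+1}&=-FF^DEF^DB_i+\bigl(F^D+FF^D(EF^D)^2\bigr)D_i. \end{aligned}$$ All the infinite series above converge. -/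

import Mathlib

/-- `B` is a Drazin inverse of the square complex matrix `A`. -/
def IsDrazinInverse {m : Type*} [Fintype m] [DecidableEq m] (A B : Matrix m m ℂ) : Prop :=
  A * B = B * A ∧ B = B * A * B ∧ ∃ k : ℕ, A ^ k = A ^ (k + 1) * B

theorem IsDrazinInverse.unique {m : Type*} [Fintype m] [DecidableEq m] {A B C : Matrix m m ℂ}
    (hB : IsDrazinInverse A B) (hC : IsDrazinInverse A C) : B = C := by
  obtain ⟨b1, b2, k, b3⟩ := hB
  obtain ⟨c1, c2, l, c3⟩ := hC
  have cb : Commute A B := b1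
  have cc : Commute A C := c1
  have powB : ∀ j : ℕ, B = B ^ (j + 1) * A ^ j := by
    intro j
    induction j with
    | zero => simp
    | succ j ih =>
      calc B = B * A * B := b2
        _ = B * A * (B ^ (j + 1) * A ^ j) := by rw [← ih]
        _ = B * (A * B ^ (j + 1)) * A ^ j := by simp only [mul_assoc]
        _ = B * (B ^ (j + 1) * A) * A ^ j := by rw [(cb.pow_right (j + 1)).eq]
        _ = B ^ (j + 1 + 1) * A ^ (j + 1) := by
          rw [pow_succ' B (j + 1), pow_succ' A j]; simp only [mul_assoc]
  have powC : ∀ j : ℕ, C = A ^ j * C ^ (j + 1) := by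
    intro j
    induction j with
    | zero => simp
    | succ j ih =>
      calc C = C * A * C := c2
        _ = A * C * C := by rw [c1]
        _ = A * (A ^ j * C ^ (j + 1)) * C := by rw [← ih]
        _ = A ^ (j + 1) * C ^ (j + 1 + 1) := by
          rw [pow_succ C (j + 1), pow_succ' A j]; simp only [mul_assoc]
  have keyC : A ^ l = A ^ (l + 1) * C := c3
  have eB : B = B * A * C := by
    calc B = B ^ (l + 1) * A ^ l := powB l
      _ = B ^ (l + 1) * (A ^ (l + 1) * C) := by rw [← keyC]
      _ = (B ^ (l + 1) * A ^ l) * A * C := by rw [pow_succ A l]; simp only [mul_assoc]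
      _ = B * A * C := by rw [← powB l]
  have keyB : A ^ k = B * A * A ^ k := by
    calc A ^ k = A ^ (k + 1) * B := b3
      _ = B * A ^ (k + 1) := (cb.pow_left (k + 1)).eq
      _ = B * A * A ^ k := by rw [pow_succ' A k, mul_assoc]
  have eC : C = B * A * C := by
    calc C = A ^ k * C ^ (k + 1) := powC k
      _ = (B * A * A ^ k) * C ^ (k + 1) := by rw [← keyB]
      _ = B * A * (A ^ k * C ^ (k + 1)) := by simp only [mul_assoc]
      _ = B * A * C := by rw [← powC k]
  exact eB.trans eC.symm

theorem exists_isDrazinInverse {m : Type*} [Fintype m] [DecidableEq m] (A : Matrix m m ℂ) :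
    ∃ B, IsDrazinInverse A B := by
  have h0 : minpoly ℂ A ≠ 0 := minpoly.ne_zero (Matrix.isIntegral A)
  obtain ⟨q, hq, hnd⟩ :=
    Polynomial.exists_eq_pow_rootMultiplicity_mul_and_not_dvd (minpoly ℂ A) h0 0
  set k := (minpoly ℂ A).rootMultiplicity 0
  rw [Polynomial.C_0, sub_zero] at hq hnd
  have hc : q.coeff 0 ≠ 0 := fun h => hnd (Polynomial.X_dvd_iff.2 h)
  have e1 : A ^ k * (Polynomial.aeval A q) = 0 := by
    have := minpoly.aeval ℂ A
    rw [hq] at this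
    simpa using this
  have e2 : Polynomial.aeval A q
      = A * Polynomial.aeval A q.divX + algebraMap ℂ (Matrix m m ℂ) (q.coeff 0) := by
    have h := congrArg (Polynomial.aeval A) (Polynomial.X_mul_divX_add q)
    rw [← h]
    simp only [map_add, map_mul, Polynomial.aeval_X, Polynomial.aeval_C]
  set R := Polynomial.aeval A q.divX with hR
  have cR : Commute A R := by
    have h : Polynomial.aeval A (Polynomial.X * q.divX)
        = Polynomial.aeval A (q.divX * Polynomial.X) := by rw [mul_comm]
    rw [map_mul, map_mul, Polynomial.aeval_X] at h
    exact h
  set S : Matrix m m ℂ := (-(q.coeff 0)⁻¹) • R with hS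
  have cS : Commute A S := cR.smul_right _
  have e3 : A ^ k = A ^ (k + 1) * S := by
    rw [e2, mul_add, ← mul_assoc, ← pow_succ, Algebra.algebraMap_eq_smul_one,
      mul_smul_comm, mul_one] at e1
    have : A ^ (k + 1) * R = -(q.coeff 0 • A ^ k) := eq_neg_of_add_eq_zero_left e1
    rw [hS, mul_smul_comm, this, smul_neg, neg_smul, neg_neg, smul_smul, inv_mul_cancel₀ hc,
      one_smul]
  have e4 : ∀ j : ℕ, A ^ k = A ^ k * (A ^ j * S ^ j) := by
    intro j
    induction j with
    | zero => simp
    | succ j ih =>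
      calc A ^ k = A ^ k * (A ^ j * S ^ j) := ih
        _ = A ^ j * (A ^ k) * S ^ j := by
          rw [← mul_assoc, ← pow_add, ← pow_add, add_comm]
        _ = A ^ j * (A ^ (k + 1) * S) * S ^ j := by rw [← e3]
        _ = (A ^ j * A ^ (k + 1)) * (S * S ^ j) := by simp only [mul_assoc]
        _ = (A ^ k * A ^ (j + 1)) * S ^ (j + 1) := by
          rw [← pow_add, ← pow_add, ← pow_succ']; congr 2; omega
        _ = A ^ k * (A ^ (j + 1) * S ^ (j + 1)) := mul_assoc _ _ _
  have cD : Commute A (A ^ k * S ^ (k + 1)) :=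
    ((Commute.refl A).pow_right k).mul_right (cS.pow_right (k + 1))
  have e5 : A ^ (k + 1) * (A ^ k * S ^ (k + 1)) = A ^ k := by
    conv_rhs => rw [e4 (k + 1)]
    rw [← mul_assoc, ← mul_assoc, ← pow_add, ← pow_add, add_comm]
  refine ⟨A ^ k * S ^ (k + 1), cD.eq, ?_, k, e5.symm⟩
  have cSk : Commute (S ^ (k + 1)) (A ^ (k + 1)) := ((cS.pow_right (k + 1)).pow_left (k + 1)).symm
  have cAS : Commute (A ^ k) (S ^ (k + 1)) := (cS.pow_right (k + 1)).pow_left k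
  calc A ^ k * S ^ (k + 1)
      = S ^ (k + 1) * A ^ k := cAS.eq
    _ = S ^ (k + 1) * (A ^ (k + 1) * (A ^ k * S ^ (k + 1))) := by rw [e5]
    _ = (S ^ (k + 1) * A ^ k) * A * (A ^ k * S ^ (k + 1)) := by
      rw [pow_succ A k]; simp only [mul_assoc]
    _ = A ^ k * S ^ (k + 1) * A * (A ^ k * S ^ (k + 1)) := by rw [cAS.eq]

/-- The Drazin inverse `A^D`; it exists and is unique for every square complex matrix. -/
noncomputable def drazinInv {m : Type*} [Fintype m] [DecidableEq m] (A : Matrix m m ℂ) :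
    Matrix m m ℂ :=
  Classical.choose (exists_isDrazinInverse A)

theorem drazinInv_spec {m : Type*} [Fintype m] [DecidableEq m] (A : Matrix m m ℂ) :
    IsDrazinInverse A (drazinInv A) :=
  Classical.choose_spec (exists_isDrazinInverse A)

/-- The eigenprojection `A^π = I - A A^D`. -/
noncomputable def drazinProj {m : Type*} [Fintype m] [DecidableEq m] (A : Matrix m m ℂ) :
    Matrix m m ℂ :=
  1 - A * drazinInv A

namespace BlockDrazin

section

variable {m : Type*} [Fintype m] [DecidableEq m]

/-- The quadruple `(A_{i+1}, B_{i+1}, C_{i+1}, D_{i+1})`; the index is shifted, so that the value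
at `0` is `(A_1, B_1, C_1, D_1)`. -/
noncomputable def coeffs (E F : Matrix m m ℂ) :
    ℕ → Matrix m m ℂ × Matrix m m ℂ × Matrix m m ℂ × Matrix m m ℂ
  | 0 =>
    let G := drazinInv F
    (-(G * E * G),
      G ^ 2 + G * (E * G) ^ 2,
      G + F * G * (E * G) ^ 2,
      -(G * E * G) - F * G * E * G ^ 2 - F * G * (E * G) ^ 3)
  | i + 1 =>
    let G := drazinInv F
    let A := (coeffs E F i).1
    let B := (coeffs E F i).2.1
    let C := (coeffs E F i).2.2.1
    let D := (coeffs E F i).2.2.2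
    (G * A - G * E * G * C,
      G * B - G * E * G * D,
      -(F * G * E * G * A) + (G + F * G * (E * G) ^ 2) * C,
      -(F * G * E * G * B) + (G + F * G * (E * G) ^ 2) * D)

/-- `A_i`, for `i ≥ 1`. -/
noncomputable def coeffA (E F : Matrix m m ℂ) (i : ℕ) : Matrix m m ℂ := (coeffs E F (i - 1)).1

/-- `B_i`, for `i ≥ 1`. -/
noncomputable def coeffB (E F : Matrix m m ℂ) (i : ℕ) : Matrix m m ℂ := (coeffs E F (i - 1)).2.1

/-- `C_i`, for `i ≥ 1`. -/
noncomputable def coeffC (E F : Matrix m m ℂ) (i : ℕ) : Matrix m m ℂ := (coeffs E F (i - 1)).2.2.1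

/-- `D_i`, for `i ≥ 1`. -/
noncomputable def coeffD (E F : Matrix m m ℂ) (i : ℕ) : Matrix m m ℂ := (coeffs E F (i - 1)).2.2.2

/-- `Φ = E^π - ∑_{j ≥ 1} (E^D)^{2j} F^j F^π`. -/
noncomputable def phi (E F : Matrix m m ℂ) : Matrix m m ℂ :=
  drazinProj E - ∑' j : ℕ, drazinInv E ^ (2 * (j + 1)) * F ^ (j + 1) * drazinProj F

/-- `U_i = Φ F^i F^π E + E^π E^{2i} F^π E F F^D
  + ∑_{k=0}^{i-2} E^π E^{2k+2} F^{i-k-1} F^π E`, for `i ≥ 1`. -/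
noncomputable def coeffU (E F : Matrix m m ℂ) (i : ℕ) : Matrix m m ℂ :=
  phi E F * F ^ i * drazinProj F * E
    + drazinProj E * E ^ (2 * i) * drazinProj F * E * F * drazinInv F
    + ∑ k ∈ Finset.range (i - 1),
        drazinProj E * E ^ (2 * k + 2) * F ^ (i - k - 1) * drazinProj F * E

/-- `V_i = E^π E^{2i-1} F^π E F F^D - ∑_{j ≥ 0} (E^D)^{2j+1} F^{i+j} F^π E
  + ∑_{k=0}^{i-2} E^π E^{2k+1} F^{i-k-1} F^π E`, for `i ≥ 1`. -/
noncomputable def coeffV (E F : Matrix m m ℂ) (i : ℕ) : Matrix m m ℂ :=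
  drazinProj E * E ^ (2 * i - 1) * drazinProj F * E * F * drazinInv F
    - ∑' j : ℕ, drazinInv E ^ (2 * j + 1) * F ^ (i + j) * drazinProj F * E
    + ∑ k ∈ Finset.range (i - 1),
        drazinProj E * E ^ (2 * k + 1) * F ^ (i - k - 1) * drazinProj F * E

/-- The block `Γ`. -/
noncomputable def Gam (E F : Matrix m m ℂ) : Matrix m m ℂ :=
  (∑' i : ℕ, drazinInv E ^ (2 * i + 1) * F ^ i * drazinProj F)
    + phi E F * drazinProj F * E * drazinInv F
    + (∑' i : ℕ, coeffU E F (i + 1) * drazinInv F * coeffC E F (i + 1))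
    + ∑' i : ℕ, coeffV E F (i + 1) * coeffA E F (i + 1)

/-- The block `Δ`. -/
noncomputable def Del (E F : Matrix m m ℂ) : Matrix m m ℂ :=
  drazinInv F - drazinInv E * drazinProj F * E * drazinInv F
    - (∑' i : ℕ, drazinInv E ^ (2 * (i + 1) + 1) * F ^ (i + 1) * drazinProj F * E * drazinInv F)
    + (∑' i : ℕ, drazinInv E ^ (2 * i + 2) * F ^ i * drazinProj F)
    - phi E F * drazinProj F * E * drazinInv F * E * drazinInv F
    + (∑' i : ℕ, coeffU E F (i + 1) * drazinInv F * coeffD E F (i + 1))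
    + ∑' i : ℕ, coeffV E F (i + 1) * coeffB E F (i + 1)

/-- The block `Λ`. -/
noncomputable def Lam (E F : Matrix m m ℂ) : Matrix m m ℂ :=
  F * drazinInv F + ∑' i : ℕ, F ^ (i + 1) * drazinProj F * E * coeffA E F (i + 1)

/-- The block `Ξ`. -/
noncomputable def Xii (E F : Matrix m m ℂ) : Matrix m m ℂ :=
  -(F * drazinInv F * E * drazinInv F)
    + ∑' i : ℕ, F ^ (i + 1) * drazinProj F * E * coeffB E F (i + 1)

/-- All the infinite series that occur in `Γ`, `Δ`, `Λ`, `Ξ` converge. -/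
structure SeriesConverge (E F : Matrix m m ℂ) : Prop where
  phi_inner : Summable fun j : ℕ => drazinInv E ^ (2 * (j + 1)) * F ^ (j + 1) * drazinProj F
  coeffV_inner : ∀ i : ℕ, 1 ≤ i →
    Summable fun j : ℕ => drazinInv E ^ (2 * j + 1) * F ^ (i + j) * drazinProj F * E
  gam₁ : Summable fun i : ℕ => drazinInv E ^ (2 * i + 1) * F ^ i * drazinProj F
  gam₂ : Summable fun i : ℕ => coeffU E F (i + 1) * drazinInv F * coeffC E F (i + 1)
  gam₃ : Summable fun i : ℕ => coeffV E F (i + 1) * coeffA E F (i + 1)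
  del₁ : Summable fun i : ℕ =>
    drazinInv E ^ (2 * (i + 1) + 1) * F ^ (i + 1) * drazinProj F * E * drazinInv F
  del₂ : Summable fun i : ℕ => drazinInv E ^ (2 * i + 2) * F ^ i * drazinProj F
  del₃ : Summable fun i : ℕ => coeffU E F (i + 1) * drazinInv F * coeffD E F (i + 1)
  del₄ : Summable fun i : ℕ => coeffV E F (i + 1) * coeffB E F (i + 1)
  lam : Summable fun i : ℕ => F ^ (i + 1) * drazinProj F * E * coeffA E F (i + 1)
  xi : Summable fun i : ℕ => F ^ (i + 1) * drazinProj F * E * coeffB E F (i + 1)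

end

end BlockDrazin

/-! The hypotheses are far stronger than they look. From `P Q² = 0` comes `(PQ)^D Q = 0`, so
multiplying `PQP(PQ)^π = 0` on the right by `Q` gives `(PQ)² = 0`. Hence `(PQ)^D = 0` and `(PQ)^π =
1`, and the second hypothesis becomes `PQP = 0`. With `E = P`, `F = PQ` this means `F E = 0` and `F²
= 0`: every coefficient `A_i, B_i, C_i, D_i` vanishes, the other series stop after two terms, and
the blocks of `H^D` can be checked directly (`drazinInv_fromBlocks_of_mul_eq_zero`).

The remaining formulas are general. Cline's formula (`drazinInv_mul_rect`) relates the Drazin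
inverses of `BC` and `CB`; it applies to `P + Q` against `N` and to `K` against `H`. Since `N = K +
L` with `K L = 0`, the Hartwig–Wang–Wei formula (`drazinInv_add`) gives `N^D`. -/

section DrazinGeneral

variable {m : Type*} [Fintype m] [DecidableEq m]

/-! ### Drazin inverses: basic identities and Cline's formula. -/

theorem IsDrazinInverse.drazinInv_eq {A B : Matrix m m ℂ} (h : IsDrazinInverse A B) :
    drazinInv A = B :=
  (drazinInv_spec A).unique h

theorem commute_drazinInv (A : Matrix m m ℂ) : Commute A (drazinInv A) :=
  (drazinInv_spec A).1

theorem drazinInv_mul_mul (A : Matrix m m ℂ) : drazinInv A * A * drazinInv A = drazinInv A :=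
  (drazinInv_spec A).2.1.symm

theorem mul_drazinInv_sq (A : Matrix m m ℂ) : A * drazinInv A ^ 2 = drazinInv A := by
  rw [sq, ← mul_assoc, (commute_drazinInv A).eq, drazinInv_mul_mul]

theorem drazinInv_sq_mul (A : Matrix m m ℂ) : drazinInv A ^ 2 * A = drazinInv A := by
  rw [← ((commute_drazinInv A).pow_right 2).eq, mul_drazinInv_sq]

theorem commute_drazinProj (A : Matrix m m ℂ) : Commute A (drazinProj A) :=
  (Commute.one_right A).sub_right ((Commute.refl A).mul_right (commute_drazinInv A))

theorem drazinInv_mul_drazinProj (A : Matrix m m ℂ) : drazinInv A * drazinProj A = 0 := by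
  rw [drazinProj, mul_sub, mul_one, ← mul_assoc, drazinInv_mul_mul, sub_self]

theorem drazinProj_mul_drazinInv (A : Matrix m m ℂ) : drazinProj A * drazinInv A = 0 := by
  rw [drazinProj, sub_mul, one_mul, (commute_drazinInv A).eq, drazinInv_mul_mul, sub_self]

theorem exists_pow_mul_drazinProj_eq_zero (A : Matrix m m ℂ) :
    ∃ r, ∀ i, r ≤ i → A ^ i * drazinProj A = 0 := by
  obtain ⟨r, hr⟩ := (drazinInv_spec A).2.2
  refine ⟨r, fun i hi => ?_⟩
  obtain ⟨j, rfl⟩ := Nat.exists_eq_add_of_le' hi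
  rw [pow_add, mul_assoc, drazinProj, mul_sub, mul_one, ← mul_assoc (A ^ r), ← pow_succ, ← hr,
    sub_self, mul_zero]

/-- If `A B = 0`, then `A B^D = 0`. -/
theorem mul_drazinInv_eq_zero {k : Type*} {A : Matrix k m ℂ} {B : Matrix m m ℂ} (h : A * B = 0) :
    A * drazinInv B = 0 := by
  rw [← mul_drazinInv_sq B, ← Matrix.mul_assoc, h, Matrix.zero_mul]

/-- If `A B = 0`, then `A^D B = 0`. -/
theorem drazinInv_mul_eq_zero {k : Type*} {A : Matrix m m ℂ} {B : Matrix m k ℂ} (h : A * B = 0) :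
    drazinInv A * B = 0 := by
  rw [← drazinInv_sq_mul A, Matrix.mul_assoc, h, Matrix.mul_zero]

theorem drazinInv_eq_zero_of_sq_eq_zero {A : Matrix m m ℂ} (h : A ^ 2 = 0) : drazinInv A = 0 :=
  IsDrazinInverse.drazinInv_eq ⟨by simp, by simp, 2, by simp [h]⟩

/-- **Cline's formula**, for rectangular factors. -/
theorem drazinInv_mul_rect {k : Type*} [Fintype k] [DecidableEq k] (B : Matrix m k ℂ)
    (C : Matrix k m ℂ) :
    drazinInv (B * C) = B * drazinInv (C * B) ^ 2 * C := by
  have hmul := mul_drazinInv_sq (C * B)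
  have hmul' := drazinInv_sq_mul (C * B)
  obtain ⟨hc, -, r, hr⟩ := drazinInv_spec (C * B)
  set X := drazinInv (C * B) with hX
  have h1 : B * C * (B * X ^ 2 * C) = B * X * C := by
    calc B * C * (B * X ^ 2 * C) = B * (C * B * X ^ 2) * C := by simp only [Matrix.mul_assoc]
      _ = _ := by rw [hmul]
  have h2 : B * X ^ 2 * C * (B * C) = B * X * C := by
    calc B * X ^ 2 * C * (B * C) = B * (X ^ 2 * (C * B)) * C := by simp only [Matrix.mul_assoc]
      _ = _ := by rw [hmul']
  -- One factor `C B` is lost in passing from `B C` to `C B`, hence the exponent `r + 1` below.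
  have hp : ∀ j : ℕ, (B * C) ^ (j + 1) = B * (C * B) ^ j * C := by
    intro j
    induction j with
    | zero => simp
    | succ j ih => rw [pow_succ, ih, pow_succ (C * B)]; simp only [Matrix.mul_assoc]
  refine IsDrazinInverse.drazinInv_eq ⟨h1.trans h2.symm, ?_, r + 1, ?_⟩
  · rw [h2]
    calc B * X ^ 2 * C = B * ((X * X * (C * B)) * X) * C := by
          rw [← sq X, hmul', ← sq]
      _ = B * (X * (C * B * X) * X) * C := by rw [hc]; simp only [Matrix.mul_assoc]
      _ = B * X * C * (B * X ^ 2 * C) := by simp only [sq, Matrix.mul_assoc]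
  · rw [pow_succ (B * C) (r + 1), Matrix.mul_assoc, h1, hp]
    calc B * (C * B) ^ r * C = B * ((C * B) ^ (r + 1) * X) * C := by rw [← hr]
      _ = B * (C * B) ^ r * C * (B * X * C) := by
        rw [pow_succ]; simp only [Matrix.mul_assoc]

/-! ### Drazin inverse of a sum `K + L` with `K L = 0`. -/

theorem summable_drazin_left (K L : Matrix m m ℂ) :
    Summable fun i : ℕ => drazinInv L ^ (i + 1) * K ^ i * drazinProj K := by
  obtain ⟨r, hr⟩ := exists_pow_mul_drazinProj_eq_zero K
  refine summable_of_ne_finset_zero (s := Finset.range r) fun i hi => ?_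
  rw [mul_assoc, hr i (by simpa using hi), mul_zero]

theorem summable_drazin_right (K L : Matrix m m ℂ) :
    Summable fun i : ℕ => L ^ i * drazinProj L * drazinInv K ^ (i + 1) := by
  obtain ⟨r, hr⟩ := exists_pow_mul_drazinProj_eq_zero L
  refine summable_of_ne_finset_zero (s := Finset.range r) fun i hi => ?_
  rw [hr i (by simpa using hi), zero_mul]

/-- Any word that starts with `K` and contains an `L` contains `K L`. -/
theorem mul_pow_add_of_mul_eq_zero {K L : Matrix m m ℂ} (h : K * L = 0) (j : ℕ) :
    K * (K + L) ^ j = K ^ (j + 1) := by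
  induction j with
  | zero => simp
  | succ j ih => rw [pow_succ, ← mul_assoc, ih, mul_add, pow_succ K j, mul_assoc, mul_assoc, h]
                 simp [pow_succ, mul_assoc]

theorem pow_add_mul_of_mul_eq_zero {K L : Matrix m m ℂ} (h : K * L = 0) (j : ℕ) :
    (K + L) ^ j * L = L ^ (j + 1) := by
  induction j with
  | zero => simp
  | succ j ih => rw [pow_succ', mul_assoc, ih, add_mul, pow_succ' L j, ← mul_assoc, h]
                 simp [pow_succ']

/-- A criterion for the Drazin inverse of a sum `K + L` with `K L = 0`. -/
theorem isDrazinInverse_add {K L X : Matrix m m ℂ} (h : K * L = 0)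
    (hc : (K + L) * X = X * (K + L)) (hK : K * X = K * drazinInv K)
    (hL : X * L = L * drazinInv L) (hX : X * (K + L) * X = X) :
    IsDrazinInverse (K + L) X := by
  obtain ⟨r₁, hr₁⟩ := exists_pow_mul_drazinProj_eq_zero K
  obtain ⟨r₂, hr₂⟩ := exists_pow_mul_drazinProj_eq_zero L
  set M := K + L with hM
  set r := max r₁ r₂
  have hcM : Commute M X := hc
  -- To `K` on its left, the complement of `M X` looks like `K^π`; to `L` on its right, like `L^π`.
  have hKZ : K * (1 - M * X) = K * drazinProj K := by
    rw [drazinProj, mul_sub, mul_sub, ← hK, hM, ← mul_assoc, mul_add, h, add_zero, mul_assoc]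
  have hZL : (1 - M * X) * L = L * drazinProj L := by
    rw [(commute_drazinProj L).eq, drazinProj, sub_mul, sub_mul, hc, ← hL, hM, mul_assoc, add_mul,
      h, zero_add, mul_assoc]
  set Z := 1 - M * X with hZ
  have hcZ : Commute M Z := (Commute.one_right M).sub_right ((Commute.refl M).mul_right hcM)
  have hZZ : Z * Z = Z := by
    have : Z * X = 0 := by rw [hZ, sub_mul, one_mul, hc, hX, sub_self]
    conv_lhs => rw [hZ, sub_mul, one_mul]
    rw [mul_assoc, hZ, mul_sub, mul_one, ← mul_assoc, hX, sub_self, mul_zero, sub_zero]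
  have hl : K * M ^ r * Z = 0 := by
    rw [mul_pow_add_of_mul_eq_zero h, pow_succ, mul_assoc, hKZ, ← mul_assoc, ← pow_succ]
    exact hr₁ _ (by omega)
  have hr : Z * M ^ r * L = 0 := by
    rw [mul_assoc, pow_add_mul_of_mul_eq_zero h, pow_succ', ← mul_assoc, hZL, mul_assoc,
      ← ((commute_drazinProj L).pow_left r).eq, ← mul_assoc, ← pow_succ']
    exact hr₂ _ (by omega)
  -- Splitting the middle factor of `M^(2r+1)` as `K + L` leaves two products, killed by `hl` and
  -- `hr` respectively.
  have hz : M ^ (r + 1 + r) * Z = 0 := by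
    calc M ^ (r + 1 + r) * Z = Z * M ^ (r + 1 + r) * Z := by
          rw [← (hcZ.pow_left _).eq, mul_assoc, hZZ]
      _ = Z * M ^ r * K * (M ^ r * Z) + Z * M ^ r * L * (M ^ r * Z) := by
          rw [pow_add, pow_succ, ← add_mul, ← mul_add, ← hM]; simp only [mul_assoc]
      _ = 0 := by rw [hr, mul_assoc (Z * M ^ r), ← mul_assoc K, hl]; simp
  refine ⟨hc, hX.symm, r + 1 + r, ?_⟩
  rw [hZ, mul_sub, mul_one, ← mul_assoc, ← pow_succ] at hz
  exact sub_eq_zero.1 hz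

/-- **Hartwig–Wang–Wei**: the Drazin inverse of `K + L` when `K L = 0`. -/
theorem drazinInv_add {K L : Matrix m m ℂ} (h : K * L = 0) :
    drazinInv (K + L) = (∑' i : ℕ, drazinInv L ^ (i + 1) * K ^ i * drazinProj K)
      + ∑' i : ℕ, L ^ i * drazinProj L * drazinInv K ^ (i + 1) := by
  obtain ⟨r₁, hr₁⟩ := exists_pow_mul_drazinProj_eq_zero K
  obtain ⟨r₂, hr₂⟩ := exists_pow_mul_drazinProj_eq_zero L
  set r := max r₁ r₂
  have hKi := fun i (hi : r ≤ i) => hr₁ i (by omega)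
  have hLi := fun i (hi : r ≤ i) => hr₂ i (by omega)
  rw [tsum_eq_sum (s := Finset.range r) (fun i hi => by
      rw [mul_assoc, hKi i (by simpa using hi), mul_zero]),
    tsum_eq_sum (s := Finset.range r) (fun i hi => by
      rw [hLi i (by simpa using hi), zero_mul])]
  set S := ∑ i ∈ Finset.range r, drazinInv L ^ (i + 1) * K ^ i * drazinProj K with hS
  set T := ∑ i ∈ Finset.range r, L ^ i * drazinProj L * drazinInv K ^ (i + 1) with hT
  have hKL' : K * drazinInv L = 0 := mul_drazinInv_eq_zero h
  have hK'L : drazinInv K * L = 0 := drazinInv_mul_eq_zero h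
  have hKLπ : K * drazinProj L = K := by
    rw [drazinProj, mul_sub, ← mul_assoc, h, zero_mul, mul_one, sub_zero]
  have hKπL : drazinProj K * L = L := by
    rw [drazinProj, sub_mul, mul_assoc, hK'L, mul_zero, one_mul, sub_zero]
  have hKS : K * S = 0 := by
    rw [hS, Finset.mul_sum]
    refine Finset.sum_eq_zero fun i _ => ?_
    rw [pow_succ']; simp only [← mul_assoc]; simp [hKL']
  have hTL : T * L = 0 := by
    rw [hT, Finset.sum_mul]
    refine Finset.sum_eq_zero fun i _ => ?_
    rw [pow_succ, mul_assoc, mul_assoc (drazinInv K ^ i), hK'L]; simp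
  -- The sums shifted by one, with the boundary terms split off.
  have hLS : L * S = L * drazinInv L * drazinProj K + S * K := by
    have e : ∀ i : ℕ, L * (drazinInv L ^ (i + 1 + 1) * K ^ (i + 1) * drazinProj K)
        = drazinInv L ^ (i + 1) * K ^ i * drazinProj K * K := fun i => by
      rw [mul_assoc _ (drazinProj K), ← (commute_drazinProj K).eq, ← mul_assoc, ← mul_assoc,
        ← mul_assoc, mul_assoc _ (K ^ i) K, ← pow_succ]
      congr 2
      rw [pow_succ' _ (i + 1), pow_succ' _ i, ← mul_assoc, ← mul_assoc, mul_assoc L, ← sq,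
        mul_drazinInv_sq]
    have hS' : S = ∑ i ∈ Finset.range (r + 1), drazinInv L ^ (i + 1) * K ^ i * drazinProj K := by
      rw [Finset.sum_range_succ, mul_assoc, hKi r le_rfl, mul_zero, add_zero]
    conv_lhs => rw [hS', Finset.mul_sum, Finset.sum_range_succ']
    rw [Finset.sum_congr rfl fun i _ => e i, ← Finset.sum_mul, ← hS, add_comm]
    simp [mul_assoc]
  have hTK : T * K = drazinProj L * (K * drazinInv K) + L * T := by
    have e : ∀ i : ℕ, L ^ (i + 1) * drazinProj L * drazinInv K ^ (i + 1 + 1) * K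
        = L * (L ^ i * drazinProj L * drazinInv K ^ (i + 1)) := fun i => by
      have e' : drazinInv K ^ (i + 1 + 1) * K = drazinInv K ^ (i + 1) := by
        rw [pow_add _ i 1, pow_one, pow_succ, pow_succ, mul_assoc _ _ (drazinInv K), ← sq,
          mul_assoc, drazinInv_sq_mul]
      rw [mul_assoc, e', pow_succ' L]
      simp only [mul_assoc]
    have hT' : T = ∑ i ∈ Finset.range (r + 1), L ^ i * drazinProj L * drazinInv K ^ (i + 1) := by
      rw [Finset.sum_range_succ, hLi r le_rfl, zero_mul, add_zero]
    conv_lhs => rw [hT', Finset.sum_mul, Finset.sum_range_succ']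
    rw [Finset.sum_congr rfl fun i _ => e i, ← Finset.mul_sum, ← hT, add_comm]
    simp [mul_assoc, (commute_drazinInv K).eq]
  -- Only the term `i = 0` survives, since `K L = 0`. If `r = 0` the sum is empty, but then `L^π =
  -- 0` forces `K = K L^π = 0`.
  have hKT : K * T = K * drazinInv K := by
    obtain hr0 | ⟨q, hq⟩ : r = 0 ∨ ∃ q, r = q + 1 := by
      cases r <;> simp
    · have h1 : drazinProj L = 0 := by simpa using hLi 0 (by omega)
      have h2 : K = 0 := by rw [← hKLπ, h1, mul_zero]
      simp [h2]
    · rw [hT, hq, Finset.mul_sum, Finset.sum_range_succ', Finset.sum_eq_zero]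
      · rw [← mul_assoc, ← mul_assoc]; simp [hKLπ]
      · intro i _
        rw [pow_succ' L]; simp only [← mul_assoc]; simp [h]
  have hSL : S * L = L * drazinInv L := by
    obtain hr0 | ⟨q, hq⟩ : r = 0 ∨ ∃ q, r = q + 1 := by
      cases r <;> simp
    · have h1 : drazinProj K = 0 := by simpa using hKi 0 (by omega)
      have h2 : L = 0 := by rw [← hKπL, h1, zero_mul]
      simp [h2]
    · rw [hS, hq, Finset.sum_mul, Finset.sum_range_succ', Finset.sum_eq_zero]
      · rw [mul_assoc, hKπL]; simp [(commute_drazinInv L).eq]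
      · intro i _
        rw [mul_assoc, hKπL, pow_succ K, mul_assoc, mul_assoc, h]; simp
  have hKX : K * (S + T) = K * drazinInv K := by rw [mul_add, hKS, hKT, zero_add]
  have hXL : (S + T) * L = L * drazinInv L := by rw [add_mul, hSL, hTL, add_zero]
  refine IsDrazinInverse.drazinInv_eq (isDrazinInverse_add h ?_ hKX hXL ?_)
  -- After cancelling `S K` and `L T`, both sides are `K K^D + L L^D - L L^D K K^D`.
  · rw [add_mul, hKX, mul_add (S + T), hXL, mul_add, hLS, add_mul, hTK, drazinProj, drazinProj]
    noncomm_ring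
  -- With `X = S + T`, `X (K + L) X = X K K^D + L L^D X`; the first summand is `T` and the second is
  -- `S`.
  · have e1 : S * (K * drazinInv K) = 0 := by
      rw [hS, Finset.sum_mul]
      refine Finset.sum_eq_zero fun i _ => ?_
      rw [(commute_drazinInv K).eq, mul_assoc, ← mul_assoc (drazinProj K),
        drazinProj_mul_drazinInv]; simp
    have e2 : T * (K * drazinInv K) = T := by
      rw [hT, Finset.sum_mul]
      refine Finset.sum_congr rfl fun i _ => ?_
      rw [mul_assoc, pow_succ, mul_assoc (drazinInv K ^ i), ← mul_assoc (drazinInv K),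
        drazinInv_mul_mul]
    have e3 : L * drazinInv L * S = S := by
      rw [hS, Finset.mul_sum]
      refine Finset.sum_congr rfl fun i _ => ?_
      rw [pow_succ']
      simp only [← mul_assoc]
      rw [(commute_drazinInv L).eq, drazinInv_mul_mul]
    have e4 : L * drazinInv L * T = 0 := by
      rw [hT, Finset.mul_sum]
      refine Finset.sum_eq_zero fun i _ => ?_
      rw [((commute_drazinProj L).pow_left i).eq]
      simp only [← mul_assoc]
      rw [mul_assoc L, drazinInv_mul_drazinProj]; simp
    rw [mul_add (S + T) K L, hXL, add_mul, mul_assoc, hKX, add_mul, e1, e2, mul_add, e3, e4]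
    abel

end DrazinGeneral

/-! ### Drazin inverses of block matrices. -/

section Blocks

variable {m : Type*} [Fintype m] [DecidableEq m]

theorem drazinInv_fromBlocks_zero (Q : Matrix m m ℂ) :
    drazinInv (Matrix.fromBlocks (0 : Matrix m m ℂ) (0 : Matrix m m ℂ) (0 : Matrix m m ℂ) Q)
      = Matrix.fromBlocks 0 0 0 (drazinInv Q) := by
  obtain ⟨h1, h2, r, hr⟩ := drazinInv_spec Q
  -- The exponent is shifted because the zeroth power has upper left block `1`.
  have hp : ∀ j : ℕ, (Matrix.fromBlocks (0 : Matrix m m ℂ) (0 : Matrix m m ℂ)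
      (0 : Matrix m m ℂ) Q) ^ (j + 1) = Matrix.fromBlocks 0 0 0 (Q ^ (j + 1)) := by
    intro j
    induction j with
    | zero => simp
    | succ j ih => rw [pow_succ, ih, Matrix.fromBlocks_multiply]; simp [pow_succ]
  refine IsDrazinInverse.drazinInv_eq ⟨?_, ?_, r + 1, ?_⟩
  · simp [Matrix.fromBlocks_multiply, h1]
  · simp [Matrix.fromBlocks_multiply, ← h2]
  · rw [hp, hp, Matrix.fromBlocks_multiply, pow_succ' Q r, hr]
    simp [pow_succ', mul_assoc]

/-- The Drazin inverse of `(E, I; F, 0)` when `F E = 0` and `F² = 0`. -/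
theorem drazinInv_fromBlocks_of_mul_eq_zero {E F : Matrix m m ℂ} (hFE : F * E = 0)
    (hF : F ^ 2 = 0) :
    drazinInv (Matrix.fromBlocks E 1 F 0)
      = Matrix.fromBlocks (drazinInv E + drazinInv E ^ 3 * F)
          (drazinInv E ^ 2 + drazinInv E ^ 4 * F) 0 0 := by
  -- For `j ≥ 3` the `j`-th power has zero lower row and upper row `(E^j + E^(j-2) F, E^(j-1) +
  -- E^(j-3) F)`. The claimed inverse is this expression at `j = -1`, with `E^D` in place of `E⁻¹`.
  have hFD : F * drazinInv E = 0 := mul_drazinInv_eq_zero hFE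
  have hED := (commute_drazinInv E).eq
  have hEDD := mul_drazinInv_sq E
  have hDED := drazinInv_mul_mul E
  obtain ⟨r, hr⟩ := exists_pow_mul_drazinProj_eq_zero E
  have hπ : drazinProj E = 1 - E * drazinInv E := rfl
  set D := drazinInv E with hD
  have hFF : F * F = 0 := by rw [← sq, hF]
  have hED3 : E * D ^ 3 = D ^ 2 := by rw [pow_succ D 2, ← mul_assoc, hEDD, sq]
  have hED4 : E * D ^ 4 = D ^ 3 := by rw [pow_succ D 3, ← mul_assoc, hED3, pow_succ D 2]
  have hFDs : ∀ j : ℕ, F * D ^ (j + 1) = 0 := fun j => by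
    rw [pow_succ', ← mul_assoc, hFD, zero_mul]
  have hX : Matrix.fromBlocks E 1 F 0 * Matrix.fromBlocks (D + D ^ 3 * F) (D ^ 2 + D ^ 4 * F) 0 0
      = Matrix.fromBlocks (E * D + D ^ 2 * F) (D + D ^ 3 * F) 0 0 := by
    rw [Matrix.fromBlocks_multiply]
    simp only [mul_add, ← mul_assoc, hED3, hED4, hEDD, hFD, hFDs, Matrix.mul_zero, zero_mul,
      add_zero]
  refine IsDrazinInverse.drazinInv_eq ⟨?_, ?_, r + 3, ?_⟩
  · rw [hX, Matrix.fromBlocks_multiply]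
    simp [add_mul, mul_assoc, hFE, hFF, hED]
  · rw [mul_assoc, hX, Matrix.fromBlocks_multiply]
    have e1 : ∀ Y : Matrix m m ℂ, F * (E * Y) = 0 := fun Y => by rw [← mul_assoc, hFE, zero_mul]
    have e3 : ∀ j : ℕ, ∀ Y : Matrix m m ℂ, F * (D ^ (j + 1) * Y) = 0 := fun j Y => by
      rw [← mul_assoc, hFDs, zero_mul]
    simp only [add_mul, mul_add, mul_assoc, e1, e3, hFD, Matrix.mul_zero, zero_mul, add_zero]
    congr 1
    · rw [← mul_assoc, hDED, ← mul_assoc, ← pow_succ']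
    · rw [← sq, ← mul_assoc, ← pow_succ']
  -- The shift by 3 keeps the exponents of `E` nonnegative. Each block carries some `E^i E^π` with
  -- `i ≥ j`, so `j = r` makes all of them vanish.
  · have key : ∀ j : ℕ, Matrix.fromBlocks E 1 F 0 ^ (j + 3)
        * (1 - Matrix.fromBlocks E 1 F 0
          * Matrix.fromBlocks (D + D ^ 3 * F) (D ^ 2 + D ^ 4 * F) 0 0)
        = Matrix.fromBlocks (E ^ (j + 3) * drazinProj E + E ^ (j + 1) * drazinProj E * F)
            (E ^ (j + 2) * drazinProj E + E ^ j * drazinProj E * F) 0 0 := by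
      intro j
      induction j with
      | zero =>
        rw [hX, ← Matrix.fromBlocks_one, sub_eq_add_neg, Matrix.fromBlocks_neg,
          Matrix.fromBlocks_add, zero_add, pow_succ, sq,
          mul_assoc, mul_assoc]
        have e1 : ∀ Y : Matrix m m ℂ, F * (E * Y) = 0 := fun Y => by
          rw [← mul_assoc, hFE, zero_mul]
        have e3 : E * (D ^ 2 * F) = D * F := by rw [← mul_assoc, hEDD]
        have e4 : E * (D ^ 3 * F) = D ^ 2 * F := by rw [← mul_assoc, hED3]
        have e5 : ∀ Y : Matrix m m ℂ, F * (D * Y) = 0 := fun Y => by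
          rw [← mul_assoc, hFD, zero_mul]
        have e6 : ∀ j : ℕ, ∀ Y : Matrix m m ℂ, F * (D ^ (j + 1) * Y) = 0 := fun j Y => by
          rw [← mul_assoc, hFDs, zero_mul]
        simp only [Matrix.fromBlocks_multiply, hπ, mul_sub, mul_add, sub_mul, mul_one, one_mul,
          mul_zero, zero_mul, add_zero, zero_add, mul_neg, mul_assoc, e1, e3, e4, e5, e6, hFE,
          hFF, hFD, pow_succ E, pow_zero, neg_zero]
        congr 1 <;> abel
      | succ j ih =>
        rw [pow_succ', mul_assoc, ih, Matrix.fromBlocks_multiply]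
        have e1 : ∀ j : ℕ, ∀ Y : Matrix m m ℂ, F * (E ^ (j + 1) * Y) = 0 := fun j Y => by
          rw [pow_succ', mul_assoc, ← mul_assoc, hFE, zero_mul]
        have e2 : F * (E ^ j * (drazinProj E * F)) = 0 := by
          -- Exponent zero also needs `F² = 0`; for positive exponents `F E = 0` suffices.
          rcases j with _ | j
          · rw [pow_zero, one_mul, hπ, sub_mul, one_mul, mul_sub, hFF, mul_assoc, ← mul_assoc F,
              hFE, zero_mul, sub_zero]
          · exact e1 j _
        simp only [mul_add, mul_assoc, e1, e2, add_zero, Matrix.mul_zero]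
        congr 1 <;> simp only [pow_succ' E, mul_assoc]
    have h0 := key r
    rw [hr (r + 3) (by omega), hr (r + 1) (by omega), hr (r + 2) (by omega), hr r le_rfl] at h0
    simp only [zero_mul, add_zero, Matrix.fromBlocks_zero] at h0
    rw [mul_sub, mul_one, ← mul_assoc, ← pow_succ] at h0
    exact sub_eq_zero.1 h0

end Blocks

/-! ### Collapse of the series when `F² = 0`. -/

namespace BlockDrazin

section NilpotentCase

variable {m : Type*} [Fintype m] [DecidableEq m] {E F : Matrix m m ℂ}

/-- Every term of the initial values and of the recursion has a factor `F^D`. -/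
theorem coeffs_eq_zero (hF : drazinInv F = 0) (i : ℕ) : coeffs E F i = 0 := by
  induction i with
  | zero => simp [coeffs, hF]
  | succ i ih => simp [coeffs, hF, ih]

theorem coeffA_eq_zero (hF : drazinInv F = 0) (i : ℕ) : coeffA E F i = 0 := by
  simp [coeffA, coeffs_eq_zero hF]

theorem coeffB_eq_zero (hF : drazinInv F = 0) (i : ℕ) : coeffB E F i = 0 := by
  simp [coeffB, coeffs_eq_zero hF]

/-- All terms with `i ≥ 2` vanish. The free exponent `e` covers the shifts `j + 1` and `i + j` in
the inner series. -/
theorem summable_mul_pow_mul (hF : F ^ 2 = 0) (u v : ℕ → Matrix m m ℂ) {e : ℕ → ℕ}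
    (he : ∀ i, i ≤ e i) : Summable fun i => u i * F ^ e i * v i := by
  refine summable_of_ne_finset_zero (s := Finset.range 2) fun i hi => ?_
  have : 2 ≤ i := by simpa [Nat.succ_le_iff] using hi
  rw [pow_eq_zero_of_le (this.trans (he i)) hF, mul_zero, zero_mul]

theorem seriesConverge_of_sq_eq_zero (hF : F ^ 2 = 0) : SeriesConverge E F where
  phi_inner := summable_mul_pow_mul hF _ (fun _ => _) (e := fun j => j + 1) fun j => by omega
  coeffV_inner i _ := by
    simpa only [mul_assoc] using summable_mul_pow_mul hF (fun j => drazinInv E ^ (2 * j + 1))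
      (fun _ => drazinProj F * E) (e := fun j => i + j) fun j => by omega
  gam₁ := summable_mul_pow_mul hF _ (fun _ => _) (e := fun i => i) fun j => le_rfl
  gam₂ := by simp [drazinInv_eq_zero_of_sq_eq_zero hF]
  gam₃ := by
    simp [coeffA_eq_zero (drazinInv_eq_zero_of_sq_eq_zero hF)]
  del₁ := by simp [drazinInv_eq_zero_of_sq_eq_zero hF]
  del₂ := summable_mul_pow_mul hF _ (fun _ => _) (e := fun i => i) fun j => le_rfl
  del₃ := by simp [drazinInv_eq_zero_of_sq_eq_zero hF]
  del₄ := by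
    simp [coeffB_eq_zero (drazinInv_eq_zero_of_sq_eq_zero hF)]
  lam := by
    simp [coeffA_eq_zero (drazinInv_eq_zero_of_sq_eq_zero hF)]
  xi := by
    simp [coeffB_eq_zero (drazinInv_eq_zero_of_sq_eq_zero hF)]

theorem tsum_mul_pow (hF : F ^ 2 = 0) (u : ℕ → Matrix m m ℂ) :
    ∑' i, u i * F ^ i = u 0 + u 1 * F := by
  rw [tsum_eq_sum (s := Finset.range 2) fun i hi => by
    rw [pow_eq_zero_of_le (by simpa [Nat.succ_le_iff] using hi) hF, mul_zero]]
  simp [Finset.sum_range_succ]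

/-- Here `F^D = 0` and `F^π = 1`, so only the terms `i = 0, 1` of the first series remain. -/
theorem Gam_of_sq_eq_zero (hF : F ^ 2 = 0) :
    Gam E F = drazinInv E + drazinInv E ^ 3 * F := by
  have hG := drazinInv_eq_zero_of_sq_eq_zero hF
  simp [Gam, coeffA_eq_zero hG, hG, drazinProj, tsum_mul_pow hF]

theorem Del_of_sq_eq_zero (hF : F ^ 2 = 0) :
    Del E F = drazinInv E ^ 2 + drazinInv E ^ 4 * F := by
  have hG := drazinInv_eq_zero_of_sq_eq_zero hF
  simp [Del, coeffB_eq_zero hG, hG, drazinProj, tsum_mul_pow hF]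

theorem Lam_of_sq_eq_zero (hF : F ^ 2 = 0) : Lam E F = 0 := by
  have hG := drazinInv_eq_zero_of_sq_eq_zero hF
  simp [Lam, coeffA_eq_zero hG, hG]

theorem Xii_of_sq_eq_zero (hF : F ^ 2 = 0) : Xii E F = 0 := by
  have hG := drazinInv_eq_zero_of_sq_eq_zero hF
  simp [Xii, coeffB_eq_zero hG, hG]

end NilpotentCase

/-- The two hypotheses `P Q² = 0` and `P Q P (P Q)^π = 0` force `P Q` to square to zero. -/
theorem mul_sq_eq_zero {m : Type*} [Fintype m] [DecidableEq m] {P Q : Matrix m m ℂ}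
    (hPQ : P * Q ^ 2 = 0) (hPQP : P * Q * P * drazinProj (P * Q) = 0) : (P * Q) ^ 2 = 0 := by
  have hGQ : drazinInv (P * Q) * Q = 0 :=
    drazinInv_mul_eq_zero (by rw [mul_assoc, ← sq, hPQ])
  -- Because `(PQ)^D Q = 0`, the projection `(PQ)^π` fixes `Q` and may be inserted before it.
  calc (P * Q) ^ 2 = P * Q * P * drazinProj (P * Q) * Q := by
        rw [drazinProj, mul_sub, mul_one, sub_mul, mul_assoc (P * Q * P) _ Q,
          mul_assoc (P * Q) (drazinInv _) Q, hGQ, mul_zero, mul_zero, sub_zero, sq,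
          mul_assoc (P * Q) P Q]
    _ = 0 := by rw [hPQP, zero_mul]

end BlockDrazin

theorem theorem2p3 (n : ℕ) (P Q : Matrix (Fin n) (Fin n) ℂ)
    (hPQ : P * Q ^ 2 = 0) (hPQP : P * Q * P * drazinProj (P * Q) = 0)
    (N K L H : Matrix (Fin n ⊕ Fin n) (Fin n ⊕ Fin n) ℂ)
    (hN : N = Matrix.fromBlocks P (P * Q) 1 Q)
    (hK : K = Matrix.fromBlocks P (P * Q) 1 0)
    (hL : L = Matrix.fromBlocks 0 0 0 Q)
    (hH : H = Matrix.fromBlocks P 1 (P * Q) 0) :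
    drazinInv (P + Q)
        = Matrix.fromCols (1 : Matrix (Fin n) (Fin n) ℂ) Q * drazinInv N ^ 2
          * Matrix.fromRows P (1 : Matrix (Fin n) (Fin n) ℂ) ∧
    (Summable fun i : ℕ => drazinInv L ^ (i + 1) * K ^ i * drazinProj K) ∧
    (Summable fun i : ℕ => L ^ i * drazinProj L * drazinInv K ^ (i + 1)) ∧
    drazinInv N
        = (∑' i : ℕ, drazinInv L ^ (i + 1) * K ^ i * drazinProj K)
          + ∑' i : ℕ, L ^ i * drazinProj L * drazinInv K ^ (i + 1) ∧
    drazinInv L = Matrix.fromBlocks 0 0 0 (drazinInv Q) ∧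
    drazinInv K
        = Matrix.fromBlocks P 1 1 0 * drazinInv H ^ 2 * Matrix.fromBlocks 1 0 0 (P * Q) ∧
    BlockDrazin.SeriesConverge P (P * Q) ∧
    drazinInv H
        = Matrix.fromBlocks (BlockDrazin.Gam P (P * Q)) (BlockDrazin.Del P (P * Q))
            (BlockDrazin.Lam P (P * Q)) (BlockDrazin.Xii P (P * Q)) := by
  have hF2 : (P * Q) ^ 2 = 0 := BlockDrazin.mul_sq_eq_zero hPQ hPQP
  have hFP : P * Q * P = 0 := by
    simpa [drazinProj, drazinInv_eq_zero_of_sq_eq_zero hF2] using hPQP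
  have hKL : K * L = 0 := by
    rw [hK, hL, Matrix.fromBlocks_multiply]
    simp [mul_assoc, ← sq, hPQ]
  have hNKL : N = K + L := by rw [hN, hK, hL, Matrix.fromBlocks_add]; simp
  refine ⟨?_, summable_drazin_left K L, summable_drazin_right K L, ?_, ?_, ?_,
    BlockDrazin.seriesConverge_of_sq_eq_zero hF2, ?_⟩
  · have e1 : P + Q = Matrix.fromCols (1 : Matrix (Fin n) (Fin n) ℂ) Q
        * Matrix.fromRows P (1 : Matrix (Fin n) (Fin n) ℂ) := by
      rw [Matrix.fromCols_mul_fromRows]; simp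
    have e2 : N = Matrix.fromRows P (1 : Matrix (Fin n) (Fin n) ℂ)
        * Matrix.fromCols (1 : Matrix (Fin n) (Fin n) ℂ) Q := by
      rw [Matrix.fromRows_mul_fromCols, hN]; simp
    rw [e1, e2, drazinInv_mul_rect]
  · rw [hNKL, drazinInv_add hKL]
  · rw [hL, drazinInv_fromBlocks_zero]
  -- `K` and `H` are products of the same two factors in opposite orders.
  · have e1 : K = Matrix.fromBlocks P 1 1 0 * Matrix.fromBlocks 1 0 0 (P * Q) := by
      rw [hK, Matrix.fromBlocks_multiply]; simp
    have e2 : H = Matrix.fromBlocks 1 0 0 (P * Q) * Matrix.fromBlocks P 1 1 0 := by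
      rw [hH, Matrix.fromBlocks_multiply]; simp
    rw [e1, e2, drazinInv_mul_rect]
  · rw [hH, drazinInv_fromBlocks_of_mul_eq_zero hFP hF2, BlockDrazin.Gam_of_sq_eq_zero hF2,
      BlockDrazin.Del_of_sq_eq_zero hF2, BlockDrazin.Lam_of_sq_eq_zero hF2,
      BlockDrazin.Xii_of_sq_eq_zero hF2]
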